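/- Let $d, m \ge 0$ be integers, let $Q = \prod_{j=1}^d [a_j, a_j+s] \subset \mathbb{R}^d$ (with $a_j \in \mathbb{R}$ and $s > 0$) be a $d$-dimensional cube, and let $(C_i)_{i\in I}$ be a finite family of closed subsets of $\mathbb{R}^d$ whose union contains $Q$, such that every point of $Q$ belongs to $C_i$ for at most $m+1$ indices $i$. Then there is an index $i$ such that $C_i$ intersects at least $d-m$ pairs of opposite facets of $Q$; that is, for at least $d-m$ of the indices $j \in \{1,\dots,d\}$ the set $C_i$ meets both facets $\{x\in Q : x_j = a_j\}$ and $\{x\in Q : x_j = a_j+s\}$. -/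

import Mathlib

/-- The `d`-dimensional cube with lowest corner `a` and side length `s`: the product of the
intervals `[a j, a j + s]`. -/
def cube {d : ℕ} (a : Fin d → ℝ) (s : ℝ) : Set (Fin d → ℝ) :=
  {x | ∀ j, x j ∈ Set.Icc (a j) (a j + s)}

/-- The facet of the cube on which the `j`-th coordinate is minimal. -/
def lowerFacet {d : ℕ} (a : Fin d → ℝ) (s : ℝ) (j : Fin d) : Set (Fin d → ℝ) :=
  {x | x ∈ cube a s ∧ x j = a j}

/-- The facet of the cube on which the `j`-th coordinate is maximal, opposite to
`lowerFacet a s j`. -/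
def upperFacet {d : ℕ} (a : Fin d → ℝ) (s : ℝ) (j : Fin d) : Set (Fin d → ℝ) :=
  {x | x ∈ cube a s ∧ x j = a j + s}

/-- The directions `j` (one for each of the `d` pairs of opposite facets of the cube) such that
the set `C` intersects both facets orthogonal to the `j`-th coordinate axis. -/
def touchedPairs {d : ℕ} (a : Fin d → ℝ) (s : ℝ) (C : Set (Fin d → ℝ)) : Set (Fin d) :=
  {j | (C ∩ lowerFacet a s j).Nonempty ∧ (C ∩ upperFacet a s j).Nonempty}

/-! Suppose each `C u` misses a facet in at least `m + 1` directions, collected in `J u`. For `j ∈ J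
u` let `c u j ∈ {0, 1}` name a side such that `C u` misses the opposite facet. Bump functions `ρ u`
supported near `C u` then give, in each direction `j`, a weighted average of the `c u j` over the
`u` with `j ∈ J u`, equal to 0 on the lower and 1 on the upper facet wherever the weights do not all
vanish. By `poincare_miranda`, these averages, suitably completed where the weights are small, take
any prescribed value `p` in the open unit cube at some point `x`. If `x ∈ C v`, the averages in the
directions `J v` are genuine. At most `m + 1` weights are nonzero at `x`, so up to scaling they have
at most `m` parameters, while at least `m + 1` coordinates of `p` are prescribed. By
`exists_generic_point` some `p` escapes all these constraints, a contradiction. `poincare_miranda`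
itself rests on a discrete version, proved by evaluating a mod 2 cup product on a lattice box. -/

/-! ### Mod 2 cubical cup products on the lattice -/

/-- The vertex of the unit lattice cube based at `x` that lies in the directions `T`. -/
def latticeShift {ι : Type*} [DecidableEq ι] (x : ι → ℕ) (T : Finset ι) : ι → ℕ :=
  fun i => if i ∈ T then x i + 1 else x i

/-- The value of the cubical cup product `δ(a 0) ∪ ⋯ ∪ δ(a (k - 1))`, modulo two, on the lattice
cube based at `x` and spanned by the directions `T`. -/
def cubicalCup {ι : Type*} [DecidableEq ι] (a : ℕ → (ι → ℕ) → ZMod 2) :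
    ℕ → (ι → ℕ) → Finset ι → ZMod 2
  | 0, _, _ => 1
  | k + 1, x, T => ∑ j ∈ T, cubicalCup a k x (T.erase j) *
      (a k (latticeShift x T) + a k (latticeShift x (T.erase j)))

theorem latticeShift_singleton_erase {ι : Type*} [DecidableEq ι] (x : ι → ℕ) {T : Finset ι} {j : ι}
    (hj : j ∈ T) : latticeShift (latticeShift x {j}) (T.erase j) = latticeShift x T := by
  ext i
  by_cases h : i = j
  · subst h; simp [latticeShift, hj]
  · simp [latticeShift, h]

theorem latticeShift_comm {ι : Type*} [DecidableEq ι] (x : ι → ℕ) (S T : Finset ι) :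
    latticeShift (latticeShift x S) T = latticeShift (latticeShift x T) S := by
  ext i
  simp only [latticeShift]
  split_ifs <;> rfl

/-- The terms at `(i, j)` and `(j, i)` cancel modulo two. -/
theorem sum_erase_symm_eq_zero {ι : Type*} [DecidableEq ι] (T : Finset ι) (f : ι → ι → ZMod 2)
    (hf : ∀ i j, f i j = f j i) : ∑ j ∈ T, ∑ i ∈ T.erase j, f j i = 0 := by
  rw [Finset.sum_sigma']
  refine Finset.sum_involution (fun p _ => ⟨p.2, p.1⟩) ?_ ?_ ?_ ?_
  · rintro ⟨i, j⟩ _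
    simp only
    rw [hf j i]
    exact CharTwo.add_self_eq_zero _
  · rintro ⟨i, j⟩ h _ heq
    simp only [Finset.mem_sigma, Finset.mem_erase] at h
    simp only [Sigma.mk.injEq] at heq
    exact h.2.1 heq.1
  · rintro ⟨i, j⟩ h
    simp only [Finset.mem_sigma, Finset.mem_erase] at h ⊢
    exact ⟨h.2.2, fun e => h.2.1 e.symm, h.1⟩
  · rintro ⟨i, j⟩ _
    rfl

/-- The cubical coboundary squares to zero. -/
theorem coboundary_coboundary {ι : Type*} [DecidableEq ι] (φ : (ι → ℕ) → Finset ι → ZMod 2)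
    (x : ι → ℕ) (T : Finset ι) :
    ∑ j ∈ T, (∑ i ∈ T.erase j, (φ (latticeShift (latticeShift x {j}) {i}) ((T.erase j).erase i) +
        φ (latticeShift x {j}) ((T.erase j).erase i)) +
      ∑ i ∈ T.erase j, (φ (latticeShift x {i}) ((T.erase j).erase i) +
        φ x ((T.erase j).erase i))) = 0 := by
  simp_rw [← Finset.sum_add_distrib]
  refine sum_erase_symm_eq_zero T _ fun i j => ?_
  rw [latticeShift_comm x {i} {j}, Finset.erase_right_comm]
  ring

/-- The cup product is the coboundary of a cochain, and it is a cocycle. -/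
theorem cubicalCup_coboundary {ι : Type*} [DecidableEq ι] (a : ℕ → (ι → ℕ) → ZMod 2) (k : ℕ) :
    (∀ x T, ∑ j ∈ T, (cubicalCup a k (latticeShift x {j}) (T.erase j) +
      cubicalCup a k x (T.erase j)) = 0) ∧
    ∀ x T, cubicalCup a (k + 1) x T = ∑ j ∈ T,
      (cubicalCup a k (latticeShift x {j}) (T.erase j) *
          a k (latticeShift (latticeShift x {j}) (T.erase j)) +
        cubicalCup a k x (T.erase j) * a k (latticeShift x (T.erase j))) := by
  have step : ∀ k, (∀ x T, ∑ j ∈ T, (cubicalCup a k (latticeShift x {j}) (T.erase j) +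
      cubicalCup a k x (T.erase j)) = 0) → ∀ x T, cubicalCup a (k + 1) x T = ∑ j ∈ T,
      (cubicalCup a k (latticeShift x {j}) (T.erase j) *
          a k (latticeShift (latticeShift x {j}) (T.erase j)) +
        cubicalCup a k x (T.erase j) * a k (latticeShift x (T.erase j))) := by
    intro k hk x T
    -- Leibniz rule: the cocycle relation times the value of `a k` at the top vertex, which is the
    -- same vertex for every `j`, is the discrepancy between the two sides.
    have h := congrArg (· * a k (latticeShift x T)) (hk x T)
    simp only [zero_mul, Finset.sum_mul] at h
    rw [cubicalCup, ← sub_eq_zero, ← Finset.sum_sub_distrib, ← h, ← sub_eq_zero,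
      ← Finset.sum_sub_distrib]
    refine Finset.sum_eq_zero fun j hj => ?_
    rw [latticeShift_singleton_erase x hj]
    have h2 : (2 : ZMod 2) = 0 := rfl
    linear_combination (-cubicalCup a k (latticeShift x {j}) (T.erase j) *
      a k (latticeShift x T)) * h2
  induction k with
  | zero =>
    refine (fun h => ⟨h, step 0 h⟩) fun x T => ?_
    exact Finset.sum_eq_zero fun j _ => CharTwo.add_self_eq_zero _
  | succ k ih =>
    refine (fun h => ⟨h, step (k + 1) h⟩) fun x T => ?_
    simp_rw [ih.2]
    exact coboundary_coboundary
      (fun x T => cubicalCup a k x T * a k (latticeShift x T)) x T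

/-- Every term of the expanded product has a factor that is a difference of two values of `a i` on
the cube. -/
theorem cubicalCup_eq_zero_of_const {ι : Type*} [DecidableEq ι] (a : ℕ → (ι → ℕ) → ZMod 2)
    (x : ι → ℕ) (i : ℕ) (c : ZMod 2) (k : ℕ) (hik : i < k) (T : Finset ι)
    (hc : ∀ U ⊆ T, a i (latticeShift x U) = c) : cubicalCup a k x T = 0 := by
  induction k generalizing T with
  | zero => omega
  | succ k ih =>
    rw [cubicalCup]
    refine Finset.sum_eq_zero fun j _ => ?_
    rcases Nat.lt_succ_iff_lt_or_eq.1 hik with h | h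
    · rw [ih h _ fun U hU => hc U (hU.trans (Finset.erase_subset _ _)), zero_mul]
    · rw [← h, hc _ subset_rfl, hc _ (Finset.erase_subset _ _), CharTwo.add_self_eq_zero,
        mul_zero]

/-- Summation over a lattice box telescopes in each direction. -/
theorem sum_piFinset_shift_sub {ι : Type*} [Fintype ι] [DecidableEq ι] {M : Type*} [AddCommGroup M]
    (s : ι → Finset ℕ) (j : ι) (N : ℕ) (hj : s j = Finset.range N) (V : (ι → ℕ) → M) :
    ∑ x ∈ Fintype.piFinset s, (V (latticeShift x {j}) - V x) =
      ∑ x ∈ Fintype.piFinset (Function.update s j {N}), V x -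
        ∑ x ∈ Fintype.piFinset (Function.update s j {0}), V x := by
  have hmem : ∀ n x, x ∈ Fintype.piFinset (Function.update s j {n}) ↔
      x j = n ∧ ∀ i, i ≠ j → x i ∈ s i := by
    intro n x
    rw [Fintype.mem_piFinset]
    refine ⟨fun h => ⟨by simpa using h j, fun i hi => by simpa [hi] using h i⟩, fun h i => ?_⟩
    by_cases hi : i = j
    · subst hi; simpa using h.1
    · simpa [hi] using h.2 i hi
  have hmaps : ∀ x ∈ Fintype.piFinset s, x j ∈ Finset.range N := fun x hx =>
    hj ▸ Fintype.mem_piFinset.1 hx j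
  rw [← Finset.sum_fiberwise_of_maps_to hmaps,
    ← Finset.sum_range_sub (fun n => ∑ x ∈ Fintype.piFinset (Function.update s j {n}), V x)]
  refine Finset.sum_congr rfl fun n hn => ?_
  have hfilter : (Fintype.piFinset s).filter (fun x => x j = n) =
      Fintype.piFinset (Function.update s j {n}) := by
    ext x
    rw [Finset.mem_filter, Fintype.mem_piFinset, hmem]
    refine ⟨fun h => ⟨h.2, fun i _ => h.1 i⟩, fun h => ⟨fun i => ?_, h.1⟩⟩
    by_cases hi : i = j
    · subst hi; rw [h.1, hj]; exact hn
    · exact h.2 i hi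
  rw [hfilter, Finset.sum_sub_distrib]
  congr 1
  refine Finset.sum_bij' (fun x _ => latticeShift x {j}) (fun x _ => Function.update x j n)
    ?_ ?_ ?_ ?_ ?_
  · intro x hx
    rw [hmem] at hx ⊢
    refine ⟨by simp [latticeShift, hx.1], fun i hi => ?_⟩
    simpa [latticeShift, hi] using hx.2 i hi
  · intro x hx
    rw [hmem] at hx ⊢
    refine ⟨by simp, fun i hi => ?_⟩
    simpa [hi] using hx.2 i hi
  · intro x hx
    ext i
    by_cases hi : i = j
    · subst hi; simp [((hmem _ _).1 hx).1]
    · simp [latticeShift, hi]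
  · intro x hx
    ext i
    by_cases hi : i = j
    · subst hi; simp [latticeShift, ((hmem _ _).1 hx).1]
    · simp [latticeShift, hi]
  · intro x _
    rfl

/-- The cup product of functions that separate opposite facets has total value one. -/
theorem sum_cubicalCup_eq_one {d N : ℕ} (a : ℕ → (Fin d → ℕ) → ZMod 2)
    (h0 : ∀ (i : Fin d) x, x i = 0 → a i x = 0) (h1 : ∀ (i : Fin d) x, x i = N → a i x = 1)
    (k : ℕ) (hk : k ≤ d) :
    ∑ x ∈ Fintype.piFinset (fun i : Fin d => if i.val < k then Finset.range N else {N}),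
      cubicalCup a k x (Finset.univ.filter fun i => i.val < k) = 1 := by
  induction k with
  | zero => simp [cubicalCup]
  | succ k ih =>
    set s : Fin d → Finset ℕ := fun i => if i.val < k + 1 then Finset.range N else {N} with hs
    set T : Finset (Fin d) := Finset.univ.filter fun i => i.val < k + 1 with hT
    let κ : Fin d := ⟨k, hk⟩
    have hκ : κ ∈ T := by simp [hT, κ]
    have hshift : ∀ (x : Fin d → ℕ) (j : Fin d) (U : Finset (Fin d)), U ⊆ T.erase j →
        latticeShift x U j = x j := fun x j U hU => by
      have : j ∉ U := fun h => by simpa using hU h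
      simp [latticeShift, this]
    have hval : ∀ j n (x : Fin d → ℕ), x ∈ Fintype.piFinset (Function.update s j {n}) →
        x j = n := fun j n x hx => by simpa using Fintype.mem_piFinset.1 hx j
    have hTκ : T.erase κ = Finset.univ.filter fun i : Fin d => i.val < k := by
      ext i
      simp only [hT, κ, Finset.mem_erase, Finset.mem_filter, Finset.mem_univ, true_and, ne_eq,
        Fin.ext_iff]
      omega
    have hsκ : Function.update s κ {N} =
        fun i : Fin d => if i.val < k then Finset.range N else {N} := by
      funext i
      by_cases hi : i = κ
      · subst hi; simp [κ]
      · have : i.val ≠ k := fun h => hi (Fin.ext h)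
        simp only [Function.update_of_ne hi, hs]
        congr 1
        simp only [eq_iff_iff]
        omega
    simp_rw [(cubicalCup_coboundary a k).2]
    rw [Finset.sum_comm]
    simp_rw [← CharTwo.sub_eq_add]
    -- By telescoping only the two end faces in direction `j` count. For `j < k` the function `a j`
    -- is constant on each, which kills the product; for `j = k` the upper face reproduces the sum
    -- for `k`.
    have key : ∀ j ∈ T, ∑ x ∈ Fintype.piFinset s,
        (cubicalCup a k (latticeShift x {j}) (T.erase j) *
          a k (latticeShift (latticeShift x {j}) (T.erase j)) -
        cubicalCup a k x (T.erase j) * a k (latticeShift x (T.erase j))) =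
        if j = κ then 1 else 0 := by
      intro j hj
      have hjs : s j = Finset.range N := by
        have : j.val < k + 1 := by simpa [hT] using hj
        simp only [hs, this, if_true]
      rw [sum_piFinset_shift_sub s j N hjs
        (fun x => cubicalCup a k x (T.erase j) * a k (latticeShift x (T.erase j)))]
      split_ifs with hjκ
      · subst hjκ
        have hzero : ∑ x ∈ Fintype.piFinset (Function.update s κ {0}),
            cubicalCup a k x (T.erase κ) * a k (latticeShift x (T.erase κ)) = 0 :=
          Finset.sum_eq_zero fun x hx => by
            rw [h0 κ _ ((hshift x κ _ subset_rfl).trans (hval _ _ _ hx)), mul_zero]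
        rw [hzero, sub_zero, ← ih (by omega), ← hsκ, ← hTκ]
        refine Finset.sum_congr rfl fun x hx => ?_
        rw [h1 κ _ ((hshift x κ _ subset_rfl).trans (hval _ _ _ hx)), mul_one]
      · have hlt : j.val < k := by
          have h1 : j.val < k + 1 := by simpa [hT] using hj
          have h2 : j.val ≠ k := fun h => hjκ (Fin.ext h)
          omega
        rw [Finset.sum_eq_zero, Finset.sum_eq_zero, sub_zero]
        · intro x hx
          rw [cubicalCup_eq_zero_of_const a x j 0 k hlt _ fun U hU =>
            h0 j _ ((hshift x j U hU).trans (hval _ _ _ hx)), zero_mul]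
        · intro x hx
          rw [cubicalCup_eq_zero_of_const a x j 1 k hlt _ fun U hU =>
            h1 j _ ((hshift x j U hU).trans (hval _ _ _ hx)), zero_mul]
    rw [Finset.sum_congr rfl key, Finset.sum_ite_eq' T κ, if_pos hκ]

/-! ### The Poincaré–Miranda theorem, discrete and continuous -/

/-- A discrete form of the Poincaré–Miranda theorem: two-valued functions on the vertices of a
lattice cube, each separating a pair of opposite facets, are simultaneously non-constant on some
unit cube. -/
theorem exists_lattice_cube_nonconstant {d N : ℕ} (P : Fin d → (Fin d → ℕ) → Prop)
    (h0 : ∀ i x, x i = 0 → ¬ P i x) (h1 : ∀ i x, x i = N → P i x) :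
    ∃ x : Fin d → ℕ, (∀ i, x i < N) ∧ ∀ i, ∃ S T : Finset (Fin d),
      P i (latticeShift x S) ∧ ¬ P i (latticeShift x T) := by
  classical
  let a : ℕ → (Fin d → ℕ) → ZMod 2 := fun k x => if h : k < d then (if P ⟨k, h⟩ x then 1 else 0)
    else 0
  have ha : ∀ (i : Fin d) x, a i x = if P i x then 1 else 0 := fun i x => by simp [a]
  have hsum := sum_cubicalCup_eq_one (N := N) a (fun i x hx => by rw [ha, if_neg (h0 i x hx)])
    (fun i x hx => by rw [ha, if_pos (h1 i x hx)]) d le_rfl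
  obtain ⟨x, hx, hne⟩ := Finset.exists_ne_zero_of_sum_ne_zero (hsum.trans_ne one_ne_zero)
  refine ⟨x, fun i => by simpa using Fintype.mem_piFinset.1 hx i, fun i => ?_⟩
  by_contra! hcon
  by_cases hP : ∃ S, P i (latticeShift x S)
  · obtain ⟨S, hS⟩ := hP
    exact hne (cubicalCup_eq_zero_of_const a x i 1 d i.2 _ fun U _ => by
      rw [ha, if_pos (hcon S U hS)])
  · push Not at hP
    exact hne (cubicalCup_eq_zero_of_const a x i 0 d i.2 _ fun U _ => by
      rw [ha, if_neg (hP U)])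

theorem isCompact_cube {d : ℕ} (a : Fin d → ℝ) (s : ℝ) : IsCompact (cube a s) := by
  have : cube a s = Set.Icc a (fun j => a j + s) := by
    ext x
    simp only [cube, Set.mem_ofPred_eq, Set.mem_Icc, Pi.le_def, forall_and]
  rw [this]
  exact isCompact_Icc

/-- The **Poincaré–Miranda theorem**. -/
theorem poincare_miranda {d : ℕ} (a : Fin d → ℝ) {s : ℝ} (hs : 0 < s)
    (g : Fin d → (Fin d → ℝ) → ℝ) (hg : ∀ j, Continuous (g j))
    (hlow : ∀ j, ∀ x ∈ lowerFacet a s j, g j x ≤ 0)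
    (hupp : ∀ j, ∀ x ∈ upperFacet a s j, 0 ≤ g j x) :
    ∃ x ∈ cube a s, ∀ j, g j x = 0 := by
  by_contra! hcon
  let G : (Fin d → ℝ) → Fin d → ℝ := fun x j => g j x
  have hG : Continuous G := continuous_pi hg
  have hK := isCompact_cube a s
  -- On a fine enough grid, a unit cube on which every `g j` changes sign has a vertex where the sup
  -- norm of `G` is below its minimum.
  obtain ⟨x₀, hx₀, hmin⟩ := hK.exists_isMinOn ⟨a, fun j => ⟨le_rfl, by linarith⟩⟩
    hG.norm.continuousOn
  have hη : 0 < ‖G x₀‖ := by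
    obtain ⟨j, hj⟩ := hcon x₀ hx₀
    exact norm_pos_iff.2 fun h => hj (congrFun h j)
  obtain ⟨δ, hδ, hunif⟩ := Metric.uniformContinuousOn_iff.1
    (hK.uniformContinuousOn_of_continuous hG.continuousOn) _ hη
  obtain ⟨n, hn⟩ := exists_nat_gt (s / δ)
  have hn0 : (0 : ℝ) < n := (div_pos hs hδ).trans hn
  have hmesh : s / n < δ := by rwa [div_lt_iff₀ hn0, mul_comm, ← div_lt_iff₀ hδ]
  have hn0' : 0 < n := by exact_mod_cast hn0
  let pt : (Fin d → ℕ) → Fin d → ℝ := fun x j => a j + s / n * x j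
  have hpt : ∀ x : Fin d → ℕ, (∀ j, x j ≤ n) → pt x ∈ cube a s := by
    intro x hx j
    have h1 : (x j : ℝ) ≤ n := by exact_mod_cast hx j
    have h2 : s / n * x j ≤ s / n * n := by gcongr
    rw [div_mul_cancel₀ _ hn0.ne'] at h2
    have h3 : 0 ≤ s / n * x j := by positivity
    exact ⟨by simp only [pt]; linarith, by simp only [pt]; linarith⟩
  -- The sign of `g j` is only weakly known on the facets, so the predicate is forced there.
  obtain ⟨x, hxn, hx⟩ := exists_lattice_cube_nonconstant (N := n)
    (fun j x => x j ≠ 0 ∧ (x j = n ∨ 0 < g j (pt x)))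
    (fun j x hx h => h.1 hx) (fun j x hx => ⟨by omega, Or.inl hx⟩)
  have hshift : ∀ S j, latticeShift x S j ≤ n := by
    intro S j
    have := hxn j
    simp only [latticeShift]
    split_ifs <;> omega
  have hxc := hpt x fun j => (hxn j).le
  have hclose : ∀ S j, |g j (pt (latticeShift x S)) - g j (pt x)| < ‖G x₀‖ := by
    intro S j
    refine lt_of_le_of_lt (dist_le_pi_dist (G (pt (latticeShift x S))) (G (pt x)) j)
      (hunif _ (hpt _ (hshift S)) _ hxc (lt_of_le_of_lt ?_ hmesh))
    refine (dist_pi_le_iff (by positivity)).2 fun i => ?_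
    rw [Real.dist_eq]
    simp only [pt, latticeShift]
    have : 0 ≤ s / n := by positivity
    split_ifs
    · push_cast
      rw [abs_le]
      constructor <;> linarith
    · simpa using this
  refine (hmin hxc).not_gt ((pi_norm_lt_iff hη).2 fun j => ?_)
  obtain ⟨S, T, hS, hT⟩ := hx j
  have h1 : 0 ≤ g j (pt (latticeShift x S)) := by
    rcases hS.2 with h | h
    · refine hupp j _ ⟨hpt _ (hshift S), ?_⟩
      simp only [pt, h]
      rw [div_mul_cancel₀ _ hn0.ne']
    · exact h.le
  have h2 : g j (pt (latticeShift x T)) ≤ 0 := by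
    by_cases h : latticeShift x T j = 0
    · refine hlow j _ ⟨hpt _ (hshift T), ?_⟩
      simp [pt, h]
    · by_contra! hlt
      exact hT ⟨h, Or.inr hlt⟩
  have h3 := abs_lt.1 (hclose S j)
  have h4 := abs_lt.1 (hclose T j)
  rw [Real.norm_eq_abs, abs_lt]
  exact ⟨by simp only [G] at *; linarith, by simp only [G] at *; linarith⟩

/-! ### Dimension count and generic target point -/

/-- Extend a family of weights on `σ \ {v}` by one at `v` and by zero outside `σ`. -/
def extendWeights {ι : Type*} [DecidableEq ι] (σ : Finset ι) (v : ι)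
    (r : {u // u ∈ σ.erase v} → ℝ) (u : ι) : ℝ :=
  if h : u ∈ σ.erase v then r ⟨u, h⟩ else if u = v then 1 else 0

theorem contDiff_extendWeights {ι : Type*} [DecidableEq ι] (σ : Finset ι) (v u : ι) :
    ContDiff ℝ 1 fun r : {u // u ∈ σ.erase v} → ℝ => extendWeights σ v r u := by
  unfold extendWeights
  split_ifs
  · exact contDiff_apply ℝ ℝ _
  · exact contDiff_const
  · exact contDiff_const

/-- The points whose coordinates in `J v` are weighted averages of the numbers `c u j`, for weights
supported on `σ` that are positive at `v`, form a set of small Hausdorff dimension. -/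
theorem dimH_weighted_averages_le {d : ℕ} {ι : Type*} [Fintype ι] [DecidableEq ι]
    (J : ι → Finset (Fin d)) (c : ι → Fin d → ℝ) (σ : Finset ι) (v : ι) (hv : v ∈ σ)
    (hσ : σ.card ≤ (J v).card) :
    dimH {p : Fin d → ℝ | ∃ ρ : ι → ℝ, (∀ u, 0 ≤ ρ u) ∧ (∀ u ∉ σ, ρ u = 0) ∧ 0 < ρ v ∧
      ∀ j ∈ J v, ∑ u, (if j ∈ J u then ρ u * c u j else 0) =
        p j * ∑ u, (if j ∈ J u then ρ u else 0)} ≤ ((d - 1 : ℕ) : ENNReal) := by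
  -- Parameters: the weights on `σ` other than that of `v`, which is scaled to 1, and the
  -- coordinates of `p` outside `J v`. There are `(σ.card - 1) + (d - (J v).card) ≤ d - 1` of them.
  let E := ({u // u ∈ σ.erase v} → ℝ) × ({j // j ∉ J v} → ℝ)
  let num : Fin d → E → ℝ := fun j e =>
    ∑ u, if j ∈ J u then extendWeights σ v e.1 u * c u j else 0
  let den : Fin d → E → ℝ := fun j e => ∑ u, if j ∈ J u then extendWeights σ v e.1 u else 0
  let Φ : E → Fin d → ℝ := fun e j => if h : j ∉ J v then e.2 ⟨j, h⟩ else num j e / den j e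
  let S : Set E := {e | ∀ u, 0 ≤ e.1 u}
  have hext : ∀ u, ContDiff ℝ 1 fun e : E => extendWeights σ v e.1 u := fun u =>
    (contDiff_extendWeights σ v u).comp contDiff_fst
  have hnum : ∀ j, ContDiff ℝ 1 (num j) := fun j => ContDiff.sum fun u _ => by
    split_ifs
    · exact (hext u).mul contDiff_const
    · exact contDiff_const
  have hden : ∀ j, ContDiff ℝ 1 (den j) := fun j => ContDiff.sum fun u _ => by
    split_ifs
    · exact hext u
    · exact contDiff_const
  have hpos : ∀ j ∈ J v, ∀ e ∈ S, 0 < den j e := by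
    intro j hj e he
    refine Finset.sum_pos' (fun u _ => ?_) ⟨v, Finset.mem_univ v, by simp [hj, extendWeights]⟩
    unfold extendWeights
    split_ifs
    exacts [he _, zero_le_one, le_rfl, le_rfl]
  have hΦ : ContDiffOn ℝ 1 Φ S := by
    refine contDiffOn_pi.2 fun j => ?_
    by_cases hj : j ∈ J v
    · simp only [Φ, hj, not_true_eq_false, dite_false]
      exact (hnum j).contDiffOn.div (hden j).contDiffOn fun e he => (hpos j hj e he).ne'
    · simp only [Φ, hj, not_false_eq_true, dite_true]
      exact ((contDiff_apply ℝ ℝ _).comp contDiff_snd).contDiffOn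
  have hS : Convex ℝ S := by
    intro e he f hf α β hα hβ _ u
    exact add_nonneg (mul_nonneg hα (he u)) (mul_nonneg hβ (hf u))
  have hdim : Module.finrank ℝ E ≤ d - 1 := by
    have h1 : (J v).card ≤ d := by simpa using Finset.card_le_univ (J v)
    have h2 : 0 < σ.card := Finset.card_pos.2 ⟨v, hv⟩
    have h3 : Module.finrank ℝ E = (σ.card - 1) + (d - (J v).card) := by
      rw [Module.finrank_prod, Module.finrank_fintype_fun_eq_card,
        Module.finrank_fintype_fun_eq_card, Fintype.card_coe, Finset.card_erase_of_mem hv,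
        Fintype.card_subtype_compl, Fintype.card_fin, Fintype.card_coe]
    omega
  calc _ ≤ dimH (Φ '' S) := dimH_mono ?_
    _ ≤ dimH S := hΦ.dimH_image_le hS subset_rfl
    _ ≤ dimH (Set.univ : Set E) := dimH_mono (Set.subset_univ _)
    _ = Module.finrank ℝ E := Real.dimH_univ_eq_finrank E
    _ ≤ _ := by exact_mod_cast hdim
  rintro p ⟨ρ, hρ0, hρσ, hρv, hρ⟩
  have hscale : ∀ u, extendWeights σ v (fun w => ρ w / ρ v) u = ρ u / ρ v := by
    intro u
    unfold extendWeights
    split_ifs with h1 h2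
    · rfl
    · rw [h2, div_self hρv.ne']
    · rw [hρσ u fun h => h1 (Finset.mem_erase.2 ⟨h2, h⟩), zero_div]
  refine ⟨(fun w => ρ w / ρ v, fun j => p j), fun u => div_nonneg (hρ0 _) hρv.le, ?_⟩
  ext j
  by_cases hj : j ∈ J v
  · have hp := hpos j hj (fun w => ρ w / ρ v, fun j => p j) fun u => div_nonneg (hρ0 _) hρv.le
    simp only [Φ, hj, not_true_eq_false, dite_false]
    rw [div_eq_iff hp.ne']
    simp only [num, den, hscale]
    have := congrArg (· / ρ v) (hρ j hj)
    simp only [mul_div_assoc, Finset.sum_div] at this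
    convert this using 2
    · split_ifs
      · ring
      · simp
    · refine Finset.sum_congr rfl fun u _ => ?_
      split_ifs <;> simp
  · simp [Φ, hj]

/-- Some point of the open unit cube is, for no weights of small support, a weighted average of the
numbers `c u j` in all the directions `j ∈ J v`. -/
theorem exists_generic_point {d m : ℕ} {ι : Type*} [Fintype ι] [DecidableEq ι]
    (J : ι → Finset (Fin d)) (hJ : ∀ u, m + 1 ≤ (J u).card) (c : ι → Fin d → ℝ) :
    ∃ p : Fin d → ℝ, (∀ j, p j ∈ Set.Ioo (0 : ℝ) 1) ∧
      ∀ σ : Finset ι, σ.card ≤ m + 1 → ∀ v ∈ σ, ∀ ρ : ι → ℝ, (∀ u, 0 ≤ ρ u) →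
        (∀ u ∉ σ, ρ u = 0) → 0 < ρ v → ∃ j ∈ J v,
          ∑ u, (if j ∈ J u then ρ u * c u j else 0) ≠
            p j * ∑ u, (if j ∈ J u then ρ u else 0) := by
  rcases isEmpty_or_nonempty ι with hι | ⟨⟨u₀⟩⟩
  · exact ⟨fun _ => 1 / 2, fun _ => by norm_num, fun _ _ v => isEmptyElim v⟩
  have hd : 0 < d := by
    have h1 : (J u₀).card ≤ d := by simpa using Finset.card_le_univ (J u₀)
    have h2 := hJ u₀
    omega
  let bad : Finset ι × ι → Set (Fin d → ℝ) := fun q =>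
    {p | ∃ ρ : ι → ℝ, (∀ u, 0 ≤ ρ u) ∧ (∀ u ∉ q.1, ρ u = 0) ∧ 0 < ρ q.2 ∧
      ∀ j ∈ J q.2, ∑ u, (if j ∈ J u then ρ u * c u j else 0) =
        p j * ∑ u, (if j ∈ J u then ρ u else 0)}
  -- Only finitely many bad sets occur, so their union still has dimension below `d` and its
  -- complement is dense.
  let Q : Set (Finset ι × ι) := {q | q.2 ∈ q.1 ∧ q.1.card ≤ m + 1}
  have hbad : dimH (⋃ q ∈ Q, bad q) < Module.finrank ℝ (Fin d → ℝ) := by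
    rw [dimH_bUnion Q.to_countable]
    refine lt_of_le_of_lt (iSup₂_le fun q hq =>
      dimH_weighted_averages_le J c q.1 q.2 hq.1 (hq.2.trans (hJ _))) ?_
    rw [Module.finrank_fin_fun]
    exact_mod_cast Nat.sub_lt hd one_pos
  have hopen : IsOpen (Set.univ.pi fun _ : Fin d => Set.Ioo (0 : ℝ) 1) :=
    isOpen_set_pi Set.finite_univ fun _ _ => isOpen_Ioo
  obtain ⟨p, hp, hpbad⟩ := (dense_compl_of_dimH_lt_finrank hbad).exists_mem_open hopen
    ⟨fun _ => 1 / 2, fun _ _ => by norm_num⟩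
  refine ⟨p, fun j => hpbad j trivial, fun σ hσ v hv ρ h0 hs hpos => ?_⟩
  by_contra! hcon
  exact hp (Set.mem_biUnion (x := (σ, v)) ⟨hv, hσ⟩ ⟨ρ, h0, hs, hpos, hcon⟩)

/-! ### Uniform bounds and bump functions on compact sets -/

/-- The sum over `σ` has a positive minimum on `K`, and any `ε` below that minimum divided by
`σ.card` works. -/
theorem eventually_exists_le_of_isCompact {X κ : Type*} [TopologicalSpace X] {K : Set X}
    (hK : IsCompact K) (σ : Finset κ) (f : κ → X → ℝ) (hf : ∀ u, Continuous (f u))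
    (h0 : ∀ u x, 0 ≤ f u x) (h : ∀ x ∈ K, ∃ u ∈ σ, f u x ≠ 0) :
    ∀ᶠ ε in nhdsWithin (0 : ℝ) (Set.Ioi 0), ∀ x ∈ K, ∃ u ∈ σ, ε ≤ f u x := by
  rcases K.eq_empty_or_nonempty with rfl | hne
  · simp
  obtain ⟨x₀, hx₀, hmin⟩ := hK.exists_isMinOn hne
    (continuous_finsetSum σ fun u _ => hf u).continuousOn
  obtain ⟨u₀, hu₀, hne₀⟩ := h x₀ hx₀
  have hpos : 0 < ∑ u ∈ σ, f u x₀ :=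
    Finset.sum_pos' (fun u _ => h0 u x₀) ⟨u₀, hu₀, (h0 u₀ x₀).lt_of_ne' hne₀⟩
  have hcard : (0 : ℝ) < σ.card := by exact_mod_cast Finset.card_pos.2 ⟨u₀, hu₀⟩
  filter_upwards [nhdsWithin_le_nhds (Iio_mem_nhds (div_pos hpos hcard))] with ε hε x hx
  by_contra! hcon
  have h1 : ∑ u ∈ σ, f u x ≤ σ.card • ε := Finset.sum_le_card_nsmul _ _ _ fun u hu => (hcon u hu).le
  rw [Set.mem_Iio, lt_div_iff₀ hcard] at hε
  rw [nsmul_eq_mul] at h1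
  have h2 : ∑ u ∈ σ, f u x₀ ≤ ∑ u ∈ σ, f u x := hmin hx
  linarith

theorem IsClosed.exists_continuous_nonneg_eq_zero_iff {X : Type*} [PseudoMetricSpace X] {C : Set X}
    (hC : IsClosed C) :
    ∃ f : X → ℝ, Continuous f ∧ (∀ x, 0 ≤ f x) ∧ ∀ x, f x = 0 ↔ x ∈ C := by
  rcases C.eq_empty_or_nonempty with rfl | hne
  -- `Metric.infDist` to the empty set is 0, so this case needs another function.
  · exact ⟨fun _ => 1, continuous_const, fun _ => zero_le_one, fun _ => by simp⟩
  · exact ⟨fun x => Metric.infDist x C, Metric.continuous_infDist_pt C,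
      fun _ => Metric.infDist_nonneg, fun x => (hC.mem_iff_infDist_zero hne).symm⟩

theorem isCompact_lowerFacet {d : ℕ} (a : Fin d → ℝ) (s : ℝ) (j : Fin d) :
    IsCompact (lowerFacet a s j) :=
  (isCompact_cube a s).inter_right (isClosed_eq (continuous_apply j) continuous_const)

theorem isCompact_upperFacet {d : ℕ} (a : Fin d → ℝ) (s : ℝ) (j : Fin d) :
    IsCompact (upperFacet a s j) :=
  (isCompact_cube a s).inter_right (isClosed_eq (continuous_apply j) continuous_const)

/-! ### The covering theorem -/

theorem corollary1 (d m : ℕ) (a : Fin d → ℝ) (s : ℝ) (hs : 0 < s)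
    {ι : Type*} [Finite ι] (C : ι → Set (Fin d → ℝ))
    (hclosed : ∀ i, IsClosed (C i))
    (hcover : cube a s ⊆ ⋃ i, C i)
    (hmult : ∀ x ∈ cube a s, {i | x ∈ C i}.encard ≤ (m : ℕ∞) + 1) :
    ∃ i, (d : ℤ) - (m : ℤ) ≤ ((touchedPairs a s (C i)).ncard : ℤ) := by
  classical
  have := Fintype.ofFinite ι
  by_contra! hcon
  let J : ι → Finset (Fin d) := fun u => (touchedPairs a s (C u)).toFinsetᶜ
  have hJmem : ∀ u j, j ∈ J u ↔ j ∉ touchedPairs a s (C u) := by simp [J]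
  have hJ : ∀ u, m + 1 ≤ (J u).card := by
    intro u
    have h := hcon u
    rw [Set.ncard_eq_toFinset_card'] at h
    rw [Finset.card_compl, Fintype.card_fin]
    omega
  -- For `j ∈ J u`, the value 0 means that `C u` misses the upper facet and 1 that it misses the
  -- lower one; a set missing both gets 1.
  let c : ι → Fin d → ℝ := fun u j => if (C u ∩ lowerFacet a s j).Nonempty then 0 else 1
  obtain ⟨p, hp, hgen⟩ := exists_generic_point J hJ c
  choose δ hδc hδ0 hδC using fun u => (hclosed u).exists_continuous_nonneg_eq_zero_iff
  have hmiss : ∀ (F : Set (Fin d → ℝ)), IsCompact F → ∀ u, ¬ (C u ∩ F).Nonempty →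
      ∀ᶠ ε in nhdsWithin (0 : ℝ) (Set.Ioi 0), ∀ x ∈ F, ε ≤ δ u x := by
    intro F hF u hu
    filter_upwards [eventually_exists_le_of_isCompact hF {u} δ hδc hδ0 fun x hx =>
      ⟨u, Finset.mem_singleton_self u, fun h => hu ⟨x, (hδC u x).1 h, hx⟩⟩] with ε hε x hx
    simpa using hε x hx
  have hlow : ∀ᶠ ε in nhdsWithin (0 : ℝ) (Set.Ioi 0), ∀ u j,
      ¬ (C u ∩ lowerFacet a s j).Nonempty → ∀ x ∈ lowerFacet a s j, ε ≤ δ u x := by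
    simp only [Filter.eventually_all]
    exact fun u j => hmiss _ (isCompact_lowerFacet a s j) u
  have hupp : ∀ᶠ ε in nhdsWithin (0 : ℝ) (Set.Ioi 0), ∀ u j,
      ¬ (C u ∩ upperFacet a s j).Nonempty → ∀ x ∈ upperFacet a s j, ε ≤ δ u x := by
    simp only [Filter.eventually_all]
    exact fun u j => hmiss _ (isCompact_upperFacet a s j) u
  have hsmall : ∀ᶠ ε in nhdsWithin (0 : ℝ) (Set.Ioi 0), ∀ σ : Finset ι, m + 1 < σ.card →
      ∀ x ∈ cube a s, ∃ u ∈ σ, ε ≤ δ u x := by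
    simp only [Filter.eventually_all]
    refine fun σ hσ => eventually_exists_le_of_isCompact (isCompact_cube a s) σ δ hδc hδ0 ?_
    intro x hx
    by_contra! hall
    have h1 : (σ : Set ι).encard ≤ {i | x ∈ C i}.encard :=
      Set.encard_le_encard fun u hu => (hδC u x).1 (hall u hu)
    have h2 := h1.trans (hmult x hx)
    rw [Set.encard_coe_eq_coe_finsetCard] at h2
    have h3 : σ.card ≤ m + 1 := by exact_mod_cast h2
    omega
  obtain ⟨ε, ⟨⟨hεlow, hεupp⟩, hεsmall⟩, hε : 0 < ε⟩ :=
    (((hlow.and hupp).and hsmall).and self_mem_nhdsWithin).exists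
  let ρ : ι → (Fin d → ℝ) → ℝ := fun u x => max 0 (ε - δ u x)
  have hρc : ∀ u, Continuous (ρ u) := fun u =>
    continuous_const.max (continuous_const.sub (hδc u))
  have hρ0 : ∀ u x, 0 ≤ ρ u x := fun u x => le_max_left _ _
  have hρzero : ∀ u x, ε ≤ δ u x → ρ u x = 0 := fun u x h => max_eq_left (by linarith)
  let α : Fin d → (Fin d → ℝ) → ℝ := fun j x => ∑ u, if j ∈ J u then ρ u x * c u j else 0
  let w : Fin d → (Fin d → ℝ) → ℝ := fun j x => ∑ u, if j ∈ J u then ρ u x else 0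
  have hαc : ∀ j, Continuous (α j) := fun j => continuous_finsetSum _ fun u _ => by
    split_ifs
    · exact (hρc u).mul continuous_const
    · exact continuous_const
  have hwc : ∀ j, Continuous (w j) := fun j => continuous_finsetSum _ fun u _ => by
    split_ifs
    · exact hρc u
    · exact continuous_const
  -- Where `w j x < ε`, the missing weight is given to the normalized coordinate of `x`, which is
  -- also 0 and 1 on the two facets. The total weight is then `max (w j x) ε`, and a zero of `g j`
  -- means that the average equals `p j`.
  let g : Fin d → (Fin d → ℝ) → ℝ := fun j x =>
    α j x + (x j - a j) / s * max 0 (ε - w j x) - p j * max (w j x) ε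
  obtain ⟨x, hx, hzero⟩ := poincare_miranda a hs g
    (fun j => by
      have := hαc j
      have := hwc j
      fun_prop)
    (by
      intro j x hx
      have hα : α j x = 0 := Finset.sum_eq_zero fun u _ => by
        by_cases hj : (C u ∩ lowerFacet a s j).Nonempty
        · simp [c, hj]
        · simp [hρzero u x (hεlow u j hj x hx)]
      have h1 : 0 ≤ p j * max (w j x) ε :=
        mul_nonneg (hp j).1.le (hε.le.trans (le_max_right _ _))
      simp only [g, hα, hx.2]
      simpa using h1)
    (by
      intro j x hx
      have hα : α j x = w j x := Finset.sum_congr rfl fun u _ => by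
        split_ifs with hj
        · by_cases hl : (C u ∩ lowerFacet a s j).Nonempty
          · have hu : ¬ (C u ∩ upperFacet a s j).Nonempty := fun h => (hJmem u j).1 hj ⟨hl, h⟩
            rw [hρzero u x (hεupp u j hu x hx), zero_mul]
          · simp [c, hl]
        · rfl
      have h1 : (x j - a j) / s = 1 := by
        rw [hx.2, add_sub_cancel_left, div_self hs.ne']
      have h2 : w j x + max 0 (ε - w j x) = max (w j x) ε := by
        rw [← max_add_add_left, add_zero, add_sub_cancel]
      have h3 : 0 ≤ (1 - p j) * max (w j x) ε :=
        mul_nonneg (sub_nonneg.2 (hp j).2.le) (hε.le.trans (le_max_right _ _))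
      simp only [g, hα, h1, one_mul, h2]
      linarith)
  obtain ⟨v, hv⟩ := Set.mem_iUnion.1 (hcover hx)
  have hρv : ρ v x = ε := by
    simp only [ρ, (hδC v x).2 hv, sub_zero]
    exact max_eq_right hε.le
  obtain ⟨j, hj, hne⟩ := hgen (Finset.univ.filter fun u => δ u x < ε)
    (by
      by_contra! hlt
      obtain ⟨u, hu, hle⟩ := hεsmall _ hlt x hx
      exact (Finset.mem_filter.1 hu).2.not_ge hle)
    v (by simpa [(hδC v x).2 hv] using hε) (fun u => ρ u x) (fun u => hρ0 u x)
    (fun u hu => hρzero u x (by simpa using hu)) (by simpa only [hρv] using hε)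
  -- Since `x ∈ C v` and `j ∈ J v`, the bump of `v` alone contributes `ε`, so the correction term
  -- vanishes.
  have hwε : ε ≤ w j x := by
    have h1 : (if j ∈ J v then ρ v x else 0) ≤ w j x :=
      Finset.single_le_sum (f := fun u => if j ∈ J u then ρ u x else 0)
        (fun u _ => by
          split_ifs
          exacts [hρ0 u x, le_rfl]) (Finset.mem_univ v)
    rwa [if_pos hj, hρv] at h1
  have h1 := hzero j
  simp only [g, max_eq_left (sub_nonpos.2 hwε), max_eq_left hwε, mul_zero, add_zero] at h1
  exact hne (sub_eq_zero.1 h1)
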